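/- **Quantized modulo ADC, $b$-bit.** Let $\lambda,B,f_s>0$, $T=1/f_s$, $\Omega=2\pi B$, and let $g\in\mathrm{PW}_\Omega$ be a real, continuous, finite-energy signal whose Fourier transform vanishes (a.e.) outside $[-\Omega,\Omega]$. Let $\beta_g$ be any number with $|g(t)|\le\beta_g$ for all $t$. Put $$\rho=\frac{\|g\|_\infty}{\lambda},\qquad \mathrm{OF}=\frac{f_s}{2B},\qquad \gamma[k]=g(kT),\qquad y[k]=\mathcal M_\lambda(\gamma[k])\quad(k\in\mathbb Z),$$ where $\mathcal M_\lambda(x)=x-2\lambda\lfloor (x+\lambda)/(2\lambda)\rfloor\in[-\lambda,\lambda)$. Let $b\ge 0$ be an integer, $q=2\lambda/2^{b}$, and let $Q(x)=-\lambda+q\left(\lfloor (x+\lambda)/q\rfloor+\tfrac12\right)$ be the uniform $b$-bit quantizer of $[-\lambda,\lambda)$. The measured samples are $y_\eta[k]=Q(y[k])=y[k]+\eta[k]$, with quantization error $\eta[k]=Q(y[k])-y[k]$. 1. The sequence $\eta$ is bounded and $\rho_\eta:=\|\eta\|_\infty/\lambda\le 2^{-b}$. 2. For every integer $N$ with $1\le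 N<b$ such that $$\mathrm{OF}>\pi\left(\frac{\rho}{1-2^{N-b}}\right)^{1/N},$$ the recovery algorithm of order $N$ below, run on $y_\eta$, $\lambda$, $\beta_g$, recovers the samples up to the quantization error and a global multiple of $2\lambda$: whatever integer $m$ is used in its last step, there is $m'\in\mathbb Z$ such that $$\tilde\gamma[k]=\gamma[k]+\eta[k]+2m'\lambda\qquad\text{for all }k\in\mathbb Z .$$ *Algorithm of order $N$.* Write $(\Delta x)[k]=x[k+1]-x[k]$ and let $\mathrm S$ be the anti-difference, $(\mathrm Sx)[k]=\sum_{m=1}^{k-1}x[m]$ for $k\ge1$ and $(\mathrm Sx)[k]=-\sum_{m=k}^{0}x[m]$ for $k\le 0$. Set $s_{(0)}=\mathcal M_\lambda(\Delta^N y_\eta)-\Delta^N y_\eta$ and $J=\left\lceil 4\left(\beta_g/\lambda+2^{N-2}\right)\right\rceil$. For $n=0,\dots,N-2$ put $$\kappa_n=\left\lfloor\frac{(\mathrm S^2s_{(n)})[1]-(\mathrm S^2s_{(n)})[J+1]}{2J\lambda}+\frac12\right\rfloor,\qquad s_{(n+1)}[k]=2\lambda\left\lfloor\frac{(\mathrm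 Ss_{(n)})[k]}{2\lambda}\right\rceil+2\lambda\kappa_n ,$$ where $\lfloor\cdot\rceil$ is rounding to the nearest integer (halves rounded up). Output $\tilde\gamma[k]=(\mathrm Ss_{(N-1)})[k]+y_\eta[k]+2m\lambda$, with an arbitrary $m\in\mathbb Z$. -/

import Mathlib

open MeasureTheory FourierTransform

namespace ModuloADC

noncomputable section

/-- The supremum norm of a real function or sequence (meaningful when it is bounded). -/
def supNorm {α : Type*} (f : α → ℝ) : ℝ := ⨆ t, |f t|

/-- Real signals in the Paley-Wiener space of finite-energy signals bandlimited to `[-Ω, Ω]`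
(in rad/s), represented by their continuous version so that point samples make sense.
The `L²` Fourier transform of Mathlib uses the ordinary frequency `ξ`, i.e. `ω = 2 π ξ`. -/
def IsPaleyWiener (Ω : ℝ) (g : ℝ → ℝ) : Prop :=
  Continuous g ∧
    ∃ hg : MemLp (fun t : ℝ => (g t : ℂ)) 2 (volume : Measure ℝ),
      ∀ᵐ ξ : ℝ ∂volume, Ω < |2 * Real.pi * ξ| → (𝓕 (hg.toLp) : Lp ℂ 2 volume) ξ = 0

/-- The centered modulo operation, with values in `[-lam, lam)`. -/
def modFold (lam x : ℝ) : ℝ := x - 2 * lam * ⌊(x + lam) / (2 * lam)⌋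

/-- Uniform samples `γ[k] = g (k T)`. -/
def samples (g : ℝ → ℝ) (T : ℝ) (k : ℤ) : ℝ := g (k * T)

/-- Modulo samples `y[k]`. -/
def moduloSamples (lam : ℝ) (g : ℝ → ℝ) (T : ℝ) (k : ℤ) : ℝ := modFold lam (samples g T k)

/-- Quantization step of a `b`-bit quantizer of `[-lam, lam)`. -/
def quantStep (lam : ℝ) (b : ℕ) : ℝ := 2 * lam / 2 ^ b

/-- The uniform `b`-bit quantizer of `[-lam, lam)`: the interval is cut into `2 ^ b` cells
`[-lam + j q, -lam + (j + 1) q)` and every point is sent to the midpoint of its cell. -/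
def quantize (lam : ℝ) (b : ℕ) (x : ℝ) : ℝ :=
  -lam + quantStep lam b * (⌊(x + lam) / quantStep lam b⌋ + 1 / 2)

/-- Quantized modulo samples: the data handed to the recovery algorithm. -/
def quantizedSamples (lam : ℝ) (b : ℕ) (g : ℝ → ℝ) (T : ℝ) (k : ℤ) : ℝ :=
  quantize lam b (moduloSamples lam g T k)

/-- The quantization error `η[k]`, so that quantized samples are `y[k] + η[k]`. -/
def quantError (lam : ℝ) (b : ℕ) (g : ℝ → ℝ) (T : ℝ) (k : ℤ) : ℝ :=
  quantizedSamples lam b g T k - moduloSamples lam g T k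

/-- The anti-difference of `x`, normalized to vanish at `k = 1`: it is `∑_{1 ≤ m < k} x[m]` for
`k ≥ 1`, and it is continued to `k ≤ 0` (as `-∑_{k ≤ m < 1} x[m]`) so that `Δ (S x) = x` on `ℤ`. -/
def antiDiff (x : ℤ → ℝ) (k : ℤ) : ℝ :=
  ∑ m ∈ Finset.Ico 1 k, x m - ∑ m ∈ Finset.Ico k 1, x m

/-- Block length `J`; the exponent is an integer, possibly negative. -/
def blockLength (N : ℕ) (lam βg : ℝ) : ℤ :=
  ⌈4 * (βg / lam + (2 : ℝ) ^ ((N : ℤ) - 2))⌉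

/-- The integer `κ` computed from the current sequence `s`. -/
def kappa (J : ℤ) (lam : ℝ) (s : ℤ → ℝ) : ℤ :=
  ⌊(antiDiff (antiDiff s) 1 - antiDiff (antiDiff s) (J + 1)) / (2 * J * lam) + 1 / 2⌋

/-- One pass of the loop: anti-difference, round to `2 lam ℤ`, and shift by `2 lam κ`. -/
def loopStep (J : ℤ) (lam : ℝ) (s : ℤ → ℝ) (k : ℤ) : ℝ :=
  2 * lam * round (antiDiff s k / lam / 2) + 2 * lam * kappa J lam s

/-- The initial sequence `M(Δ^N y) - Δ^N y` computed from the measured data `y`. -/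
def initialSeq (N : ℕ) (lam : ℝ) (y : ℤ → ℝ) (k : ℤ) : ℝ :=
  modFold lam (((fwdDiff (1 : ℤ))^[N] y) k) - ((fwdDiff (1 : ℤ))^[N] y) k

/-- Unfolded samples returned by the fixed-order difference recovery algorithm of order `N`,
run on the data `y` with threshold `lam` and amplitude bound `βg`; `m` is the integer that the
algorithm leaves free in its last line. The loop is passed `N - 1` times. -/
def recover (N : ℕ) (lam βg : ℝ) (m : ℤ) (y : ℤ → ℝ) (k : ℤ) : ℝ :=
  antiDiff ((loopStep (blockLength N lam βg) lam)^[N - 1] (initialSeq N lam y)) k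
    + y k + 2 * m * lam

/-- Amplitude scaling factor `ρ`. -/
def ampFactor (lam : ℝ) (g : ℝ → ℝ) : ℝ := supNorm g / lam

/-- Normalized noise level `ρ_η`. -/
def noiseLevel (lam : ℝ) (η : ℤ → ℝ) : ℝ := supNorm η / lam

/-- Oversampling factor relative to the Nyquist rate. -/
def overFactor (fs B : ℝ) : ℝ := fs / (2 * B)

end

end ModuloADC

/-! Write γ + η = y_η + 2λe with e integer-valued. If |Δ^N(γ + η)| < λ, then folding Δ^N y_η returns
Δ^N(γ + η) itself, so s_(0) = Δ^N(2λe) exactly; no error enters the loop, and only the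
anti-differences have to be controlled.

Smallness comes from Bernstein's inequality with its sharp constant. Together with the mean value
inequality it gives |Δ^N γ| ≤ (ΩT)^N ‖g‖∞, where ΩT = π/OF, while |Δ^N η| ≤ 2^N λ 2^{-b}. The
oversampling condition says precisely that these two bounds add up to less than λ.

Each pass recovers Δ^{j+1}e from Δ^{j+2}e up to an integer constant. A second summation turns that
constant into a slope over J steps; since Δ^j(2λe) is bounded, J is long enough for rounding to find
the slope (`loopStep_fwdDiff_fwdDiff`). The constant of the final summation stays unknown and is the
global multiple of 2λ. -/

namespace ModuloADC

/-! ### Bandlimited signals as transforms of integrable spectra -/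

open Real Complex in
/-- A continuous `L²` signal whose Fourier transform vanishes outside `[-B, B]` is the Fourier
transform of an integrable function vanishing outside `[-B, B]`. -/
theorem IsPaleyWiener.exists_fourier_eq {B : ℝ} {g : ℝ → ℝ}
    (hg : IsPaleyWiener (2 * π * B) g) :
    ∃ f : ℝ → ℂ, Integrable f ∧ (∀ ξ, B < |ξ| → f ξ = 0) ∧ ∀ t, 𝓕 f t = (g t : ℂ) := by
  obtain ⟨hcont, hmem, hsupp⟩ := hg
  set G : Lp ℂ 2 (volume : Measure ℝ) := hmem.toLp with hG
  set F : Lp ℂ 2 (volume : Measure ℝ) := 𝓕 G with hF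
  set F' : ℝ → ℂ := (Set.Icc (-B) B).indicator F with hF'
  have hFF' : (F : ℝ → ℂ) =ᵐ[volume] F' := by
    filter_upwards [hsupp] with ξ hξ
    by_cases h : ξ ∈ Set.Icc (-B) B
    · simp [hF', h]
    · simp only [hF', h, not_false_eq_true, Set.indicator_of_notMem]
      apply hξ
      rw [abs_mul, abs_of_pos two_pi_pos]
      have : B < |ξ| := by
        contrapose! h
        exact abs_le.mp h
      exact mul_lt_mul_of_pos_left this two_pi_pos
  have hint : Integrable F' := by
    rw [hF', integrable_indicator_iff measurableSet_Icc]
    exact ((Lp.memLp F).restrict _).integrable (by norm_num)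
  have hcinv : Continuous (𝓕⁻ F') := by
    rw [Real.fourierInv_eq_fourier_comp_neg]
    exact VectorFourier.fourierIntegral_continuous Real.continuous_fourierChar
      (by exact continuous_inner) hint.comp_neg
  -- The L² inverse transform and the inverse integral are compared by pairing with test functions;
  -- both sides being continuous, they then agree everywhere.
  have hmain : (fun t => (g t : ℂ)) =ᵐ[volume] 𝓕⁻ F' := by
    have hGg : (G : ℝ → ℂ) =ᵐ[volume] fun t => (g t : ℂ) := hmem.coeFn_toLp
    refine ae_eq_of_integral_contDiff_smul_eq
      ((Complex.continuous_ofReal.comp hcont).locallyIntegrable) hcinv.locallyIntegrable ?_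
    intro φ φ_smooth φ_cpt
    have h₁ : HasCompactSupport (Complex.ofRealCLM ∘ φ) := φ_cpt.comp_left rfl
    have h₂ : ContDiff ℝ (↑(⊤ : ℕ∞)) (Complex.ofRealCLM ∘ φ) := by fun_prop
    set ψ : SchwartzMap ℝ ℂ := h₁.toSchwartzMap h₂ with hψ
    have hψa : ∀ x, ψ x = (φ x : ℂ) := fun x => rfl
    have e1 := congrArg (fun d => d ψ) (Lp.fourierInv_toTemperedDistribution_eq F)
    have e2 : (𝓕⁻ F : Lp ℂ 2 (volume : Measure ℝ)) = G := by
      rw [hF]; exact FourierTransform.fourierInv_fourier_eq G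
    simp only [e2, TemperedDistribution.fourierInv_apply, Lp.toTemperedDistribution_apply] at e1
    calc _ = ∫ x, ψ x • G x := by
          apply integral_congr_ae
          filter_upwards [hGg] with x hx
          rw [hx, hψa]; simp
      _ = ∫ x, (𝓕⁻ ψ) x • F x := e1.symm
      _ = ∫ x, (𝓕⁻ (ψ : ℝ → ℂ)) x • F' x := by
          apply integral_congr_ae
          filter_upwards [hFF'] with x hx
          rw [hx, SchwartzMap.fourierInv_coe]
      _ = ∫ x, (ψ x) • (𝓕⁻ F') x := by
          have hflip : (-(innerₗ ℝ)).flip = -(innerₗ ℝ) := by ext; simp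
          have h := VectorFourier.integral_fourierIntegral_smul_eq_flip (L := -(innerₗ ℝ))
            (μ := volume) (ν := volume) Real.continuous_fourierChar (by
              have h : Continuous fun p : ℝ × ℝ => -(p.2 * p.1) := by fun_prop
              simpa using! h) ψ.integrable hint
          rw [hflip] at h
          exact h
      _ = _ := by simp [hψa]
  have heq := (Continuous.ae_eq_iff_eq volume (Complex.continuous_ofReal.comp hcont) hcinv).mp hmain
  refine ⟨fun ξ => F' (-ξ), hint.comp_neg, ?_, ?_⟩
  · intro ξ hξ
    have : -ξ ∉ Set.Icc (-B) B := by
      rw [Set.mem_Icc, ← abs_le, abs_neg]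
      exact not_le.mpr hξ
    simp [hF', this]
  · intro t
    rw [← Real.fourierInv_eq_fourier_comp_neg]
    exact (congrFun heq t).symm

/-! ### Fourier series of the triangle wave -/

open Real in
theorem hasSum_cos_div_sq {x : ℝ} (hx : x ∈ Set.Icc (0 : ℝ) 1) :
    HasSum (fun n : ℕ => 1 / (n : ℝ) ^ 2 * cos (2 * π * n * x))
      (π ^ 2 * (x ^ 2 - x + 1 / 6)) := by
  have h := hasSum_one_div_nat_pow_mul_cos one_ne_zero hx
  have hp : (Polynomial.map (algebraMap ℚ ℝ) (Polynomial.bernoulli (2 * 1))).eval x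
      = x ^ 2 - x + 1 / 6 := by
    simp [Polynomial.bernoulli, Finset.sum_range_succ]
    ring
  rw [hp] at h
  convert h using 1
  norm_num [Nat.factorial]
  ring

/-- The coefficients `1 / n ^ 2` for odd `n`, and `0` for even `n`. -/
noncomputable def oddInvSq (n : ℕ) : ℝ := if Odd n then 1 / (n : ℝ) ^ 2 else 0

theorem oddInvSq_nonneg (n : ℕ) : 0 ≤ oddInvSq n := by
  unfold oddInvSq
  split_ifs <;> positivity

-- Odd terms are all terms minus even ones, and the even ones are a quarter of the full series at
-- 2x; hence the restriction x ≤ 1/2.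
open Real in
theorem hasSum_oddInvSq_mul_cos {x : ℝ} (hx : x ∈ Set.Icc (0 : ℝ) (1 / 2)) :
    HasSum (fun n : ℕ => oddInvSq n * cos (2 * π * n * x)) (π ^ 2 * (1 / 8 - x / 2)) := by
  have h1 := hasSum_cos_div_sq (x := x) ⟨hx.1, hx.2.trans (by norm_num)⟩
  have h2 := (hasSum_cos_div_sq (x := 2 * x)
    ⟨by linarith [hx.1], by linarith [hx.2]⟩).mul_left (1 / 4)
  have h3 : HasSum (fun n : ℕ => if Even n then 1 / (n : ℝ) ^ 2 * cos (2 * π * n * x) else 0)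
      (1 / 4 * (π ^ 2 * ((2 * x) ^ 2 - 2 * x + 1 / 6))) := by
    have hinj : Function.Injective (fun n : ℕ => 2 * n) := fun a b h => by simpa using h
    rw [← hinj.hasSum_iff]
    · refine (congrArg (fun F : ℕ → ℝ => HasSum F _) (funext fun n => ?_)).mpr h2
      simp only [Function.comp_apply, even_two_mul, if_true, Nat.cast_mul, Nat.cast_ofNat]
      rw [show 2 * π * (2 * (n : ℝ)) * x = 2 * π * n * (2 * x) by ring, mul_pow]
      ring
    · intro n hn
      rw [if_neg]
      rintro ⟨k, hk⟩
      exact hn ⟨k, (two_mul k).trans hk.symm⟩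
  have heq : (fun n : ℕ => oddInvSq n * cos (2 * π * n * x)) = fun n : ℕ =>
      1 / (n : ℝ) ^ 2 * cos (2 * π * n * x) -
        if Even n then 1 / (n : ℝ) ^ 2 * cos (2 * π * n * x) else 0 := by
    funext n
    rcases Nat.even_or_odd n with h | h
    · simp [oddInvSq, h, Nat.not_odd_iff_even.mpr h]
    · simp [oddInvSq, h, Nat.not_even_iff_odd.mpr h]
  rw [heq, show π ^ 2 * (1 / 8 - x / 2) = π ^ 2 * (x ^ 2 - x + 1 / 6) -
    1 / 4 * (π ^ 2 * ((2 * x) ^ 2 - 2 * x + 1 / 6)) by ring]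
  exact h1.sub h3

open Real in
theorem hasSum_oddInvSq : HasSum oddInvSq (π ^ 2 / 8) := by
  have h := hasSum_oddInvSq_mul_cos (x := 0) ⟨le_rfl, by norm_num⟩
  convert h using 1
  · simp
  · ring

open Real in
/-- The Fourier series of the triangle wave on its rising branch. -/
theorem hasSum_triangle {B ξ : ℝ} (hB : 0 < B) (hξ : |ξ| ≤ B) :
    HasSum (fun n : ℕ => oddInvSq n * cos (n * (π / 2) - n * (π * ξ / (2 * B))))
      (π ^ 2 / (8 * B) * ξ) := by
  have hB' : ξ / (4 * B) ∈ Set.Icc (-(1 / 4) : ℝ) (1 / 4) := by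
    rw [Set.mem_Icc, ← abs_le, abs_div, abs_of_pos (by positivity : 0 < 4 * B),
      div_le_iff₀ (by positivity)]
    linarith
  have h := hasSum_oddInvSq_mul_cos (x := 1 / 4 - ξ / (4 * B))
    ⟨by linarith [hB'.2], by linarith [hB'.1]⟩
  convert h using 1
  · funext n
    congr 2
    field_simp
    ring
  · field_simp
    ring

/-! ### Bernstein's inequality and iterated differences -/

theorem integrable_fourierChar_smul {f : ℝ → ℂ} (hf : Integrable f) (t : ℝ) :
    Integrable fun ξ => 𝐞 (-(ξ * t)) • f ξ := by
  simpa [mul_comm] using! (Real.fourierIntegral_convergent_iff (μ := volume) (f := f) t).2 hf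

-- A cosine multiplier averages two translates with unimodular weights, so it does not increase the
-- sup norm.
open Real Complex in
theorem integral_cos_mul_fourierChar {f : ℝ → ℂ} (hf : Integrable f) (θ s t : ℝ) :
    ∫ ξ, (Real.cos (θ - 2 * π * ξ * s) : ℂ) * (𝐞 (-(ξ * t)) • f ξ) =
      (cexp (θ * I) * 𝓕 f (t + s) + cexp (-θ * I) * 𝓕 f (t - s)) / 2 := by
  rw [Real.fourier_real_eq, Real.fourier_real_eq, ← integral_const_mul, ← integral_const_mul,
    ← integral_add ((integrable_fourierChar_smul hf _).const_mul _)
      ((integrable_fourierChar_smul hf _).const_mul _), ← integral_div]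
  congr 1
  funext ξ
  simp only [Circle.smul_def, Real.fourierChar_apply, smul_eq_mul, Complex.ofReal_cos, Complex.cos]
  rw [show cexp (↑(2 * π * -(ξ * (t + s))) * I) =
      cexp (↑(2 * π * -(ξ * t)) * I) * cexp (-(2 * π * ξ * s) * I) by
        rw [← Complex.exp_add]; push_cast; ring_nf,
    show cexp (↑(2 * π * -(ξ * (t - s))) * I) =
      cexp (↑(2 * π * -(ξ * t)) * I) * cexp ((2 * π * ξ * s) * I) by
        rw [← Complex.exp_add]; push_cast; ring_nf,
    show cexp (↑(θ - 2 * π * ξ * s) * I) = cexp (θ * I) * cexp (-(2 * π * ξ * s) * I) by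
        rw [← Complex.exp_add]; push_cast; ring_nf,
    show cexp (-↑(θ - 2 * π * ξ * s) * I) = cexp (-θ * I) * cexp ((2 * π * ξ * s) * I) by
        rw [← Complex.exp_add]; push_cast; ring_nf]
  ring

theorem norm_integral_cos_mul_fourierChar_le {f : ℝ → ℂ} (hf : Integrable f) {M : ℝ}
    (hM : ∀ t, ‖𝓕 f t‖ ≤ M) (θ s t : ℝ) :
    ‖∫ ξ, (Real.cos (θ - 2 * Real.pi * ξ * s) : ℂ) * (𝐞 (-(ξ * t)) • f ξ)‖ ≤ M := by
  rw [integral_cos_mul_fourierChar hf, norm_div]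
  have h1 : ‖Complex.exp (θ * Complex.I) * 𝓕 f (t + s)‖ ≤ M := by
    rw [norm_mul, Complex.norm_exp_ofReal_mul_I, one_mul]; exact hM _
  have h2 : ‖Complex.exp (-θ * Complex.I) * 𝓕 f (t - s)‖ ≤ M := by
    rw [norm_mul, ← Complex.ofReal_neg, Complex.norm_exp_ofReal_mul_I, one_mul]; exact hM _
  have := norm_add_le (Complex.exp (θ * Complex.I) * 𝓕 f (t + s))
    (Complex.exp (-θ * Complex.I) * 𝓕 f (t - s))
  simp only [Complex.norm_ofNat]
  linarith

/-- Bernstein's inequality, by the argument of M. Riesz: the multiplier `ξ` is expanded into the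
Fourier series of the triangle wave. -/
theorem norm_integral_mul_fourierChar_le {B : ℝ} (hB : 0 < B) {f : ℝ → ℂ} (hf : Integrable f)
    (hsupp : ∀ ξ, B < |ξ| → f ξ = 0) {M : ℝ} (hM : ∀ t, ‖𝓕 f t‖ ≤ M) (t : ℝ) :
    ‖∫ ξ : ℝ, (ξ : ℂ) * (𝐞 (-(ξ * t)) • f ξ)‖ ≤ B * M := by
  set u : ℝ → ℂ := fun ξ => 𝐞 (-(ξ * t)) • f ξ with hu
  have hui : Integrable u := integrable_fourierChar_smul hf t
  set c : ℕ → ℝ → ℝ := fun n ξ =>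
    Real.cos (n * (Real.pi / 2) - 2 * Real.pi * ξ * (n / (4 * B))) with hc
  set F : ℕ → ℝ → ℂ := fun n ξ => (oddInvSq n : ℂ) * ((c n ξ : ℂ) * u ξ) with hF
  have hcu : ∀ n, Integrable fun ξ => (c n ξ : ℂ) * u ξ := fun n =>
    hui.bdd_mul (c := 1) (by
      refine Continuous.aestronglyMeasurable ?_
      simp only [hc]; fun_prop) (ae_of_all _ fun ξ => by
        rw [Complex.norm_real]; exact Real.abs_cos_le_one _)
  have hFi : ∀ n, Integrable (F n) := fun n => (hcu n).const_mul _
  have hFn : Summable fun n => ∫ ξ, ‖F n ξ‖ := by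
    refine Summable.of_nonneg_of_le (fun n => integral_nonneg fun _ => norm_nonneg _) (fun n => ?_)
      (hasSum_oddInvSq.summable.mul_right (∫ ξ, ‖u ξ‖))
    rw [← integral_const_mul]
    refine integral_mono (hFi n).norm (hui.norm.const_mul _) fun ξ => ?_
    simp only [hF, norm_mul, Complex.norm_real, Real.norm_of_nonneg (oddInvSq_nonneg n)]
    refine mul_le_mul_of_nonneg_left ?_ (oddInvSq_nonneg n)
    exact mul_le_of_le_one_left (norm_nonneg _) (Real.abs_cos_le_one _)
  have hsum := hasSum_integral_of_summable_integral_norm hFi hFn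
  have htsum : ∀ ξ, ∑' n, F n ξ = ((Real.pi ^ 2 / (8 * B) : ℝ) : ℂ) * ((ξ : ℂ) * u ξ) := by
    intro ξ
    rcases le_or_gt |ξ| B with h | h
    · have h1 := (Complex.hasSum_ofReal.mpr (hasSum_triangle hB h)).mul_right (u ξ)
      rw [← mul_assoc, ← Complex.ofReal_mul, ← h1.tsum_eq]
      congr 1
      funext n
      simp only [hF, hc]
      rw [← mul_assoc, ← Complex.ofReal_mul]
      congr 4
      field_simp
      ring
    · have : u ξ = 0 := by simp [hu, hsupp ξ h]
      simp [hF, this]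
  simp only [htsum, integral_const_mul] at hsum
  have hbound : ∀ n, ‖∫ ξ, F n ξ‖ ≤ oddInvSq n * M := by
    intro n
    simp only [hF, integral_const_mul, norm_mul, Complex.norm_real,
      Real.norm_of_nonneg (oddInvSq_nonneg n)]
    exact mul_le_mul_of_nonneg_left (norm_integral_cos_mul_fourierChar_le hf hM _ _ t)
      (oddInvSq_nonneg n)
  -- The coefficients sum to π²/8 and the series represents π²ξ/(8B): the quotient is exactly B.
  have hle := tsum_of_norm_bounded (hasSum_oddInvSq.mul_right M) hbound
  have hpi := Real.pi_pos
  rw [hsum.tsum_eq, norm_mul, Complex.norm_real, Real.norm_of_nonneg (by positivity)] at hle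
  have h8 : 0 < Real.pi ^ 2 / (8 * B) := by positivity
  refine le_of_mul_le_mul_left (hle.trans_eq ?_) h8
  field_simp

/-- A difference with step `T` of a signal bandlimited to `|ξ| ≤ B`. -/
theorem norm_fwdDiff_fourier_le {B T : ℝ} (hB : 0 < B) (hT : 0 ≤ T) {f : ℝ → ℂ}
    (hf : Integrable f) (hsupp : ∀ ξ, B < |ξ| → f ξ = 0) {M : ℝ} (hM : ∀ t, ‖𝓕 f t‖ ≤ M) (t : ℝ) :
    ‖fwdDiff T (𝓕 f) t‖ ≤ 2 * Real.pi * B * T * M := by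
  have hf' : Integrable fun x : ℝ => x • f x := by
    refine (hf.norm.const_mul B).mono' (by
      exact (continuous_id.aestronglyMeasurable).smul hf.aestronglyMeasurable) (ae_of_all _ fun x => ?_)
    rcases le_or_gt |x| B with h | h
    · rw [norm_smul]; exact mul_le_mul_of_nonneg_right h (norm_nonneg _)
    · simp [hsupp x h]
  have hder : ∀ x ∈ (Set.univ : Set ℝ), HasDerivWithinAt (𝓕 f)
      (𝓕 (fun x : ℝ => (-2 * Real.pi * Complex.I * x) • f x) x) Set.univ x := fun x _ =>
    (Real.hasDerivAt_fourier hf hf' x).hasDerivWithinAt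
  have hbd : ∀ x ∈ (Set.univ : Set ℝ),
      ‖𝓕 (fun x : ℝ => (-2 * Real.pi * Complex.I * x) • f x) x‖ ≤ 2 * Real.pi * (B * M) := by
    intro x _
    rw [Real.fourier_real_eq]
    have : ∀ v : ℝ, 𝐞 (-(v * x)) • (-2 * Real.pi * Complex.I * v) • f v =
        (-2 * Real.pi * Complex.I) * ((v : ℂ) * (𝐞 (-(v * x)) • f v)) := by
      intro v
      simp only [Circle.smul_def, smul_eq_mul]
      ring
    simp only [this, integral_const_mul, norm_mul]
    have h2 : ‖(-2 : ℂ)‖ * ‖(Real.pi : ℂ)‖ * ‖Complex.I‖ = 2 * Real.pi := by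
      simp [abs_of_pos Real.pi_pos]
    rw [h2]
    exact mul_le_mul_of_nonneg_left (norm_integral_mul_fourierChar_le hB hf hsupp hM x)
      Real.two_pi_pos.le
  have h := convex_univ.norm_image_sub_le_of_norm_hasDerivWithin_le hder hbd
    (Set.mem_univ t) (Set.mem_univ (t + T))
  rw [add_sub_cancel_left, Real.norm_of_nonneg hT] at h
  refine h.trans_eq ?_
  ring

/-- A difference acts on the spectrum as a multiplier, so the band is preserved and the one-step
bound can be iterated. -/
theorem fwdDiff_fourier_eq {f : ℝ → ℂ} (hf : Integrable f) (T : ℝ) :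
    fwdDiff T (𝓕 f) = 𝓕 (fun ξ => (𝐞 (-(ξ * T)) : ℂ) * f ξ - f ξ) := by
  funext t
  rw [fwdDiff, Real.fourier_real_eq, Real.fourier_real_eq, Real.fourier_real_eq,
    ← integral_sub (integrable_fourierChar_smul hf _) (integrable_fourierChar_smul hf _)]
  congr 1
  funext ξ
  rw [mul_add, neg_add, AddChar.map_add_eq_mul]
  simp only [Circle.smul_def, smul_eq_mul, Circle.coe_mul]
  ring

theorem norm_fwdDiff_iter_fourier_le {B T : ℝ} (hB : 0 < B) (hT : 0 ≤ T) (N : ℕ) :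
    ∀ (f : ℝ → ℂ) (M : ℝ), Integrable f → (∀ ξ, B < |ξ| → f ξ = 0) → (∀ t, ‖𝓕 f t‖ ≤ M) →
      ∀ t, ‖(fwdDiff T)^[N] (𝓕 f) t‖ ≤ (2 * Real.pi * B * T) ^ N * M := by
  induction N with
  | zero => intro f M _ _ hM t; simpa using hM t
  | succ n ih =>
    intro f M hf hsupp hM t
    have hd := norm_fwdDiff_fourier_le hB hT hf hsupp hM
    rw [Function.iterate_succ_apply, fwdDiff_fourier_eq hf T]
    rw [fwdDiff_fourier_eq hf T] at hd
    refine (ih _ _ ?_ ?_ hd t).trans_eq (by ring)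
    · exact (integrable_fourierChar_smul hf T).sub hf
    · intro ξ hξ; simp [hsupp ξ hξ]

theorem fwdDiff_iter_samples (g : ℝ → ℝ) (T : ℝ) (N : ℕ) (k : ℤ) :
    (((fwdDiff (1 : ℤ))^[N] (samples g T) k : ℝ) : ℂ) =
      (fwdDiff T)^[N] (fun t => (g t : ℂ)) (k * T) := by
  induction N generalizing k with
  | zero => simp [samples]
  | succ n ih =>
    rw [Function.iterate_succ_apply', Function.iterate_succ_apply', fwdDiff, fwdDiff,
      Complex.ofReal_sub, ih, ih]
    push_cast
    ring_nf

/-- The `N`-th difference of the samples of a bandlimited signal. -/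
theorem IsPaleyWiener.abs_fwdDiff_iter_samples_le {B T : ℝ} (hB : 0 < B) (hT : 0 ≤ T)
    {g : ℝ → ℝ} (hg : IsPaleyWiener (2 * Real.pi * B) g) {M : ℝ} (hM : ∀ t, |g t| ≤ M)
    (N : ℕ) (k : ℤ) :
    |(fwdDiff (1 : ℤ))^[N] (samples g T) k| ≤ (2 * Real.pi * B * T) ^ N * M := by
  obtain ⟨f, hf, hsupp, hfg⟩ := hg.exists_fourier_eq
  have h := norm_fwdDiff_iter_fourier_le hB hT N f M hf hsupp
    (fun t => by rw [hfg, Complex.norm_real]; exact hM t) (k * T)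
  rwa [show 𝓕 f = fun t => (g t : ℂ) from funext hfg, ← fwdDiff_iter_samples, Complex.norm_real]
    at h



/-! ### Folding, quantization and differences of sequences -/

theorem modFold_of_mem {lam x : ℝ} (h1 : -lam ≤ x) (h2 : x < lam) : modFold lam x = x := by
  have hlam : 0 < lam := by linarith
  have : ⌊(x + lam) / (2 * lam)⌋ = 0 := by
    rw [Int.floor_eq_zero_iff, Set.mem_Ico, div_lt_one (by positivity)]
    exact ⟨div_nonneg (by linarith) (by positivity), by linarith⟩
  simp [modFold, this]

theorem modFold_add_mul_int {lam : ℝ} (hlam : 0 < lam) (x : ℝ) (n : ℤ) :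
    modFold lam (x + 2 * lam * n) = modFold lam x := by
  have : (x + 2 * lam * n + lam) / (2 * lam) = (x + lam) / (2 * lam) + n := by
    field_simp
    ring
  rw [modFold, modFold, this, Int.floor_add_intCast]
  push_cast
  ring

theorem modFold_mem {lam : ℝ} (hlam : 0 < lam) (x : ℝ) :
    -lam ≤ modFold lam x ∧ modFold lam x < lam := by
  have h2 : (0 : ℝ) < 2 * lam := by positivity
  have h := Int.floor_le ((x + lam) / (2 * lam))
  have h' := Int.lt_floor_add_one ((x + lam) / (2 * lam))
  rw [le_div_iff₀ h2] at h
  rw [div_lt_iff₀ h2] at h'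
  unfold modFold
  constructor <;> linarith

theorem abs_quantize_sub_le {lam : ℝ} (hlam : 0 < lam) (b : ℕ) (x : ℝ) :
    |quantize lam b x - x| ≤ lam * (2 : ℝ) ^ (-(b : ℤ)) := by
  have hq : 0 < quantStep lam b := by unfold quantStep; positivity
  have h := Int.floor_le ((x + lam) / quantStep lam b)
  have h' := Int.lt_floor_add_one ((x + lam) / quantStep lam b)
  rw [le_div_iff₀ hq] at h
  rw [div_lt_iff₀ hq] at h'
  have e : lam * (2 : ℝ) ^ (-(b : ℤ)) = quantStep lam b / 2 := by
    rw [quantStep, zpow_neg, zpow_natCast]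
    ring
  rw [e, quantize, abs_le]
  constructor <;> linarith

theorem abs_quantError_le {lam : ℝ} (hlam : 0 < lam) (b : ℕ) (g : ℝ → ℝ) (T : ℝ) (k : ℤ) :
    |quantError lam b g T k| ≤ lam * (2 : ℝ) ^ (-(b : ℤ)) :=
  abs_quantize_sub_le hlam b _

theorem abs_fwdDiff_iter_le {x : ℤ → ℝ} {C : ℝ} (hx : ∀ k, |x k| ≤ C) (n : ℕ) (k : ℤ) :
    |(fwdDiff (1 : ℤ))^[n] x k| ≤ 2 ^ n * C := by
  induction n generalizing k with
  | zero => simpa using hx k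
  | succ n ih =>
    rw [Function.iterate_succ_apply', fwdDiff, pow_succ]
    have := abs_sub ((fwdDiff (1 : ℤ))^[n] x (k + 1)) ((fwdDiff (1 : ℤ))^[n] x k)
    linarith [ih k, ih (k + 1)]

theorem fwdDiff_iter_sub (x z : ℤ → ℝ) (n : ℕ) (k : ℤ) :
    (fwdDiff (1 : ℤ))^[n] (fun k => x k - z k) k =
      (fwdDiff (1 : ℤ))^[n] x k - (fwdDiff (1 : ℤ))^[n] z k := by
  induction n generalizing k with
  | zero => rfl
  | succ n ih =>
    simp only [Function.iterate_succ_apply', fwdDiff, ih]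
    ring

theorem fwdDiff_iter_mul_intCast (c : ℝ) (e : ℤ → ℤ) (n : ℕ) (k : ℤ) :
    (fwdDiff (1 : ℤ))^[n] (fun k => c * (e k : ℝ)) k = c * ((fwdDiff (1 : ℤ))^[n] e k : ℤ) := by
  induction n generalizing k with
  | zero => rfl
  | succ n ih =>
    simp only [Function.iterate_succ_apply', fwdDiff, ih]
    push_cast
    ring

/-! ### Anti-differences and the loop -/

theorem antiDiff_one (x : ℤ → ℝ) : antiDiff x 1 = 0 := by simp [antiDiff]

theorem antiDiff_add_one (x : ℤ → ℝ) (k : ℤ) : antiDiff x (k + 1) = antiDiff x k + x k := by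
  unfold antiDiff
  rcases le_or_gt 1 k with h | h
  · rw [← Finset.insert_Ico_right_eq_Ico_add_one h, Finset.sum_insert (by simp),
      Finset.Ico_eq_empty (a := k + 1) (by lia), Finset.Ico_eq_empty (a := k) (by lia)]
    simp only [Finset.sum_empty]
    ring
  · rw [← Finset.insert_Ico_add_one_left_eq_Ico h, Finset.sum_insert (by simp),
      Finset.Ico_eq_empty (b := k + 1) (by lia), Finset.Ico_eq_empty (b := k) (by lia)]
    simp only [Finset.sum_empty]
    ring

theorem antiDiff_eq_sub {x F : ℤ → ℝ} (h : ∀ k, F (k + 1) - F k = x k) (k : ℤ) :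
    antiDiff x k = F k - F 1 := by
  induction k using Int.inductionOn' (b := 1) with
  | zero => simp [antiDiff_one]
  | succ k _ ih => rw [antiDiff_add_one, ih, ← h]; ring
  | pred k _ ih =>
    have h1 := antiDiff_add_one x (k - 1)
    have h2 := h (k - 1)
    rw [sub_add_cancel] at h1 h2
    linarith

theorem antiDiff_mul_fwdDiff (c : ℝ) (v : ℤ → ℤ) (k : ℤ) :
    antiDiff (fun k => c * (fwdDiff (1 : ℤ) v k : ℤ)) k = c * ((v k - v 1 : ℤ) : ℝ) := by
  rw [antiDiff_eq_sub (F := fun k => c * (v k : ℝ))]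
  · push_cast; ring
  · intro k; simp only [fwdDiff]; push_cast; ring

/-- One pass of the loop inverts one difference of a `2 lam ℤ`-valued sequence. -/
theorem loopStep_fwdDiff_fwdDiff {lam : ℝ} (hlam : 0 < lam) {J : ℤ} (hJ : 0 < J) (v : ℤ → ℤ)
    (hv : |2 * lam * (v (J + 1) : ℝ) - 2 * lam * (v 1 : ℝ)| < J * lam) (k : ℤ) :
    loopStep J lam (fun k => 2 * lam * (fwdDiff (1 : ℤ) (fwdDiff (1 : ℤ) v) k : ℤ)) k =
      2 * lam * (fwdDiff (1 : ℤ) v k : ℤ) := by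
  have hJ' : (0 : ℝ) < J := by exact_mod_cast hJ
  have hS := funext (antiDiff_mul_fwdDiff (2 * lam) (fwdDiff (1 : ℤ) v))
  have hSS : ∀ k, antiDiff (fun k => 2 * lam * ((fwdDiff (1 : ℤ) v k - fwdDiff (1 : ℤ) v 1 : ℤ) : ℝ)) k
      = 2 * lam * (v k - v 1 - (k - 1) * (fwdDiff (1 : ℤ) v 1 : ℤ)) := by
    intro k
    rw [antiDiff_eq_sub (F := fun k : ℤ => 2 * lam * ((v k : ℝ) - k * (fwdDiff (1 : ℤ) v 1 : ℤ)))]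
    · push_cast; ring
    · intro k; simp only [fwdDiff]; push_cast; ring
  -- The double sum at J + 1 is 2λ(v(J+1) − v(1) − JΔv(1)). Divided by −2Jλ it misses Δv(1) by less
  -- than 1/2, so rounding is exact.
  have hk : kappa J lam (fun k => 2 * lam * (fwdDiff (1 : ℤ) (fwdDiff (1 : ℤ) v) k : ℤ))
      = fwdDiff (1 : ℤ) v 1 := by
    rw [kappa, hS, antiDiff_one, hSS, Int.floor_eq_iff]
    have e : (0 - 2 * lam * ((v (J + 1) : ℝ) - v 1 - (((J + 1 : ℤ) : ℝ) - 1) *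
        (fwdDiff (1 : ℤ) v 1 : ℤ))) / (2 * J * lam) + 1 / 2 = (fwdDiff (1 : ℤ) v 1 : ℤ)
          + (1 / 2 - (2 * lam * (v (J + 1) : ℝ) - 2 * lam * (v 1 : ℝ)) / (2 * (J * lam))) := by
      push_cast
      field_simp
      ring
    have hlt : |(2 * lam * (v (J + 1) : ℝ) - 2 * lam * (v 1 : ℝ)) / (2 * (J * lam))| < 1 / 2 := by
      rw [abs_div, abs_of_pos (by positivity : 0 < 2 * (J * lam)), div_lt_iff₀ (by positivity)]
      linarith
    rw [abs_lt] at hlt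
    rw [e]
    constructor <;> linarith [hlt.1, hlt.2]
  rw [loopStep, hk, hS]
  rw [show 2 * lam * ((fwdDiff (1 : ℤ) v k - fwdDiff (1 : ℤ) v 1 : ℤ) : ℝ) / lam / 2
    = ((fwdDiff (1 : ℤ) v k - fwdDiff (1 : ℤ) v 1 : ℤ) : ℝ) by field_simp, round_intCast]
  push_cast
  ring

theorem loopStep_iterate {lam : ℝ} (hlam : 0 < lam) {J : ℤ} (hJ : 0 < J) (e : ℤ → ℤ) {N : ℕ}
    (he : ∀ j : ℕ, j + 2 ≤ N → |2 * lam * ((fwdDiff (1 : ℤ))^[j] e (J + 1) : ℤ) -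
      2 * lam * ((fwdDiff (1 : ℤ))^[j] e 1 : ℤ)| < J * lam) (n : ℕ) (hn : n + 1 ≤ N) :
    (loopStep J lam)^[n] (fun k => 2 * lam * ((fwdDiff (1 : ℤ))^[N] e k : ℤ)) =
      fun k => 2 * lam * ((fwdDiff (1 : ℤ))^[N - n] e k : ℤ) := by
  induction n with
  | zero => rfl
  | succ n ih =>
    obtain ⟨j, rfl⟩ : ∃ j, N = j + 2 + n := ⟨N - 2 - n, by omega⟩
    rw [Function.iterate_succ_apply', ih (by omega), show j + 2 + n - n = j + 1 + 1 by omega,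
      show j + 2 + n - (n + 1) = j + 1 by omega]
    funext k
    rw [Function.iterate_succ_apply', Function.iterate_succ_apply']
    exact loopStep_fwdDiff_fwdDiff hlam hJ _ (he j (by omega)) k

/-! ### Exactness of the recovery -/

/-- The integer sequence `e` with `γ - y = 2 lam e`. -/
noncomputable def foldCount (lam : ℝ) (g : ℝ → ℝ) (T : ℝ) (k : ℤ) : ℤ :=
  ⌊(samples g T k + lam) / (2 * lam)⌋

theorem samples_eq_moduloSamples_add (lam : ℝ) (g : ℝ → ℝ) (T : ℝ) (k : ℤ) :
    samples g T k = moduloSamples lam g T k + 2 * lam * foldCount lam g T k := by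
  simp [moduloSamples, modFold, foldCount]

theorem quantizedSamples_eq (lam : ℝ) (b : ℕ) (g : ℝ → ℝ) (T : ℝ) (k : ℤ) :
    quantizedSamples lam b g T k =
      samples g T k + quantError lam b g T k - 2 * lam * foldCount lam g T k := by
  rw [samples_eq_moduloSamples_add lam, quantError]
  ring

/-- Δ^N y_η and Δ^N(γ + η) differ by a multiple of 2λ, which folding ignores, and the latter already
lies in the folding range. -/
theorem initialSeq_eq {lam : ℝ} (hlam : 0 < lam) (b : ℕ) (g : ℝ → ℝ) (T : ℝ) (N : ℕ) (k : ℤ)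
    (h : |(fwdDiff (1 : ℤ))^[N] (fun k => samples g T k + quantError lam b g T k) k| < lam) :
    initialSeq N lam (quantizedSamples lam b g T) k =
      2 * lam * ((fwdDiff (1 : ℤ))^[N] (foldCount lam g T) k : ℤ) := by
  rw [initialSeq, funext (quantizedSamples_eq lam b g T), fwdDiff_iter_sub,
    fwdDiff_iter_mul_intCast]
  set a := (fwdDiff (1 : ℤ))^[N] (fun k => samples g T k + quantError lam b g T k) k
  set c := (fwdDiff (1 : ℤ))^[N] (foldCount lam g T) k
  rw [abs_lt] at h
  have h1 := modFold_add_mul_int hlam a (-c)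
  rw [show a + 2 * lam * ((-c : ℤ) : ℝ) = a - 2 * lam * c by push_cast; ring,
    modFold_of_mem h.1.le h.2] at h1
  rw [h1]
  ring

/-- The left side bounds the difference of two values of Δ^j(2λe). The largest j needed is N − 2,
and the factor 4 in J, twice what is required, makes the inequality strict. -/
theorem lt_blockLength_mul {lam : ℝ} (hlam : 0 < lam) {βg : ℝ} (hβ : 0 ≤ βg) {N j : ℕ}
    (hj : j + 2 ≤ N) : 2 * (βg + 2 ^ j * lam) < blockLength N lam βg * lam := by
  have h := Int.le_ceil (4 * (βg / lam + (2 : ℝ) ^ ((N : ℤ) - 2)))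
  have h1 : (2 : ℝ) ^ j ≤ (2 : ℝ) ^ ((N : ℤ) - 2) := by
    rw [← zpow_natCast]
    exact zpow_le_zpow_right₀ (by norm_num) (by omega)
  have h2 : 4 * (βg / lam + (2 : ℝ) ^ j) ≤ blockLength N lam βg := by
    unfold blockLength; linarith
  have h3 := mul_le_mul_of_nonneg_right h2 hlam.le
  have h4 : 4 * (βg / lam + (2 : ℝ) ^ j) * lam = 4 * (βg + 2 ^ j * lam) := by field_simp
  have h5 : 0 < (2 : ℝ) ^ j * lam := by positivity
  linarith

theorem blockLength_pos {lam : ℝ} (hlam : 0 < lam) {βg : ℝ} (hβ : 0 ≤ βg) (N : ℕ) :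
    0 < blockLength N lam βg := by
  rw [blockLength, Int.ceil_pos]
  positivity

/-- Recovery from the bounds on the differences that the algorithm needs. -/
theorem recover_eq {lam : ℝ} (hlam : 0 < lam) {βg : ℝ} (hβ : 0 ≤ βg) (b : ℕ) (g : ℝ → ℝ) (T : ℝ)
    {N : ℕ} (hN : 1 ≤ N)
    (hinit : ∀ k, |(fwdDiff (1 : ℤ))^[N] (fun k => samples g T k + quantError lam b g T k) k| < lam)
    (hfold : ∀ j : ℕ, j + 2 ≤ N → ∀ k, |(fwdDiff (1 : ℤ))^[j] (fun k =>
      2 * lam * (foldCount lam g T k : ℝ)) k| ≤ βg + 2 ^ j * lam) (m : ℤ) (k : ℤ) :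
    recover N lam βg m (quantizedSamples lam b g T) k =
      samples g T k + quantError lam b g T k + 2 * (m - foldCount lam g T 1 : ℤ) * lam := by
  have hs : (loopStep (blockLength N lam βg) lam)^[N - 1]
      (initialSeq N lam (quantizedSamples lam b g T)) =
        fun k => 2 * lam * (fwdDiff (1 : ℤ) (foldCount lam g T) k : ℤ) := by
    rw [funext fun k => initialSeq_eq hlam b g T N k (hinit k),
      loopStep_iterate hlam (blockLength_pos hlam hβ N) _ _ (N - 1) (by omega),
      show N - (N - 1) = 1 by omega]
    · rfl
    · intro j hj
      have h := hfold j hj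
      simp only [fwdDiff_iter_mul_intCast] at h
      refine (abs_sub _ _).trans_lt ?_
      linarith [h (blockLength N lam βg + 1), h 1, lt_blockLength_mul hlam hβ hj]
  rw [recover, hs, antiDiff_mul_fwdDiff, quantizedSamples_eq]
  push_cast
  ring

theorem abs_le_supNorm {α : Type*} {f : α → ℝ} {C : ℝ} (hf : ∀ t, |f t| ≤ C) (t : α) :
    |f t| ≤ supNorm f :=
  le_ciSup (f := fun t => |f t|) ⟨C, by rintro _ ⟨t, rfl⟩; exact hf t⟩ t

/-- Since 2πB/f_s = π/OF, this is the oversampling condition raised to the power N. -/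
theorem mul_lt_of_pi_mul_rpow_lt {r d B fs lam s : ℝ} (hB : 0 < B) (hfs : 0 < fs) (hlam : 0 < lam)
    (hs : 0 ≤ s) (hd : 0 < d) (hr : r = s / lam) {N : ℕ} (hN : 1 ≤ N)
    (h : Real.pi * (r / d) ^ (1 / (N : ℝ)) < overFactor fs B) :
    (2 * Real.pi * B * (1 / fs)) ^ N * s < lam * d := by
  have hr0 : 0 ≤ r / d := by subst hr; positivity
  have hpi := Real.pi_pos
  set x := 2 * Real.pi * B * (1 / fs) with hx
  have hxpos : 0 < x := by positivity
  have hlt : x * (r / d) ^ (1 / (N : ℝ)) < 1 := by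
    rw [overFactor, lt_div_iff₀ (by positivity)] at h
    rw [hx, show 2 * Real.pi * B * (1 / fs) * (r / d) ^ (1 / (N : ℝ)) =
      Real.pi * (r / d) ^ (1 / (N : ℝ)) * (2 * B) / fs by ring, div_lt_one hfs]
    exact h
  have hpow := pow_lt_one₀ (mul_nonneg hxpos.le (Real.rpow_nonneg hr0 _)) hlt (by omega : N ≠ 0)
  rw [mul_pow, one_div, Real.rpow_inv_natCast_pow hr0 (by omega), ← mul_div_assoc,
    div_lt_one hd, hr, ← mul_div_assoc, div_lt_iff₀ hlam] at hpow
  linarith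

theorem foldCount_bound {lam B T : ℝ} (hlam : 0 < lam) (hB : 0 < B) (hT : 0 ≤ T)
    {g : ℝ → ℝ} (hg : IsPaleyWiener (2 * Real.pi * B) g) {βg s : ℝ} (hs : ∀ t, |g t| ≤ s)
    (hβ : 0 ≤ βg) (hsβ : s ≤ βg) {N : ℕ}
    (hsmall : (2 * Real.pi * B * T) ^ N * s < lam) (j : ℕ) (k : ℤ) :
    |(fwdDiff (1 : ℤ))^[j] (fun k => 2 * lam * (foldCount lam g T k : ℝ)) k| ≤
      βg + 2 ^ j * lam := by
  have hx : 0 ≤ 2 * Real.pi * B * T := by have := Real.pi_pos; positivity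
  have hs0 : 0 ≤ s := (abs_nonneg _).trans (hs 0)
  have hform : (fun k => 2 * lam * (foldCount lam g T k : ℝ)) =
      fun k => samples g T k - moduloSamples lam g T k := by
    funext k; rw [samples_eq_moduloSamples_add lam]; ring
  -- If s < λ nothing is folded and e = 0. Otherwise `hsmall` forces ΩT ≤ 1, so lower-order
  -- differences of γ are at most s as well.
  rcases lt_or_ge s lam with hlt | hge
  · have h0 : (fun k => 2 * lam * (foldCount lam g T k : ℝ)) = fun _ => 0 := by
      rw [hform]
      funext k
      have h := abs_lt.mp ((hs (k * T)).trans_lt hlt)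
      rw [moduloSamples, modFold_of_mem (x := samples g T k) h.1.le h.2, sub_self]
    have h1 := abs_fwdDiff_iter_le (x := fun _ => 0) (C := 0) (by simp) j k
    rw [h0]
    have : 0 ≤ 2 ^ j * lam := by positivity
    linarith
  · have hx1 : 2 * Real.pi * B * T ≤ 1 := by
      by_contra! hcon
      have := one_le_pow₀ hcon.le (n := N)
      nlinarith
    rw [hform, fwdDiff_iter_sub]
    have h1 := hg.abs_fwdDiff_iter_samples_le hB hT hs j k
    have h2 : (2 * Real.pi * B * T) ^ j * s ≤ s := mul_le_of_le_one_left hs0 (pow_le_one₀ hx hx1)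
    have h3 := abs_fwdDiff_iter_le (x := moduloSamples lam g T) (C := lam) (fun k => by
      have := modFold_mem hlam (samples g T k)
      exact abs_le.mpr ⟨this.1, this.2.le⟩) j k
    refine (abs_sub _ _).trans ?_
    linarith

end ModuloADC

theorem mainTheorem4 (lam B fs βg : ℝ) (b : ℕ) (g : ℝ → ℝ)
    (hlam : 0 < lam) (hB : 0 < B) (hfs : 0 < fs)
    (hg : ModuloADC.IsPaleyWiener (2 * Real.pi * B) g)
    (hβg : ∀ t, |g t| ≤ βg) :
    (BddAbove (Set.range fun k : ℤ => |ModuloADC.quantError lam b g (1 / fs) k|) ∧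
      ModuloADC.noiseLevel lam (ModuloADC.quantError lam b g (1 / fs)) ≤ (2 : ℝ) ^ (-(b : ℤ))) ∧
    ∀ N : ℕ, 1 ≤ N → N < b →
      Real.pi * (ModuloADC.ampFactor lam g / (1 - (2 : ℝ) ^ ((N : ℤ) - (b : ℤ)))) ^ (1 / (N : ℝ))
        < ModuloADC.overFactor fs B →
      ∀ m : ℤ, ∃ m' : ℤ, ∀ k : ℤ,
        ModuloADC.recover N lam βg m (ModuloADC.quantizedSamples lam b g (1 / fs)) k =
          ModuloADC.samples g (1 / fs) k + ModuloADC.quantError lam b g (1 / fs) k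
            + 2 * m' * lam := by
  have hη := ModuloADC.abs_quantError_le hlam b g (1 / fs)
  refine ⟨⟨⟨_, by rintro _ ⟨k, rfl⟩; exact hη k⟩, ?_⟩, ?_⟩
  · rw [ModuloADC.noiseLevel, div_le_iff₀ hlam, mul_comm]
    exact ciSup_le hη
  intro N hN hNb hOF m
  have hβ : 0 ≤ βg := (abs_nonneg _).trans (hβg 0)
  have hs := ModuloADC.abs_le_supNorm hβg
  have hT : 0 ≤ 1 / fs := by positivity
  have hp1 : (2 : ℝ) ^ ((N : ℤ) - (b : ℤ)) < 1 := zpow_lt_one_of_neg₀ (by norm_num) (by omega)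
  have hp0 : 0 < (2 : ℝ) ^ ((N : ℤ) - (b : ℤ)) := by positivity
  have hsmall := ModuloADC.mul_lt_of_pi_mul_rpow_lt hB hfs hlam ((abs_nonneg _).trans (hs 0))
    (sub_pos.mpr hp1) rfl hN hOF
  -- Unification fixes the witness: m minus the fold count at k = 1, where the anti-difference
  -- vanishes.
  refine ⟨_, fun k => ModuloADC.recover_eq hlam hβ b g (1 / fs) hN (fun k => ?_)
    (fun j _ k => ModuloADC.foldCount_bound hlam hB hT hg hs hβ (ciSup_le hβg)
      (hsmall.trans ?_) j k) m k⟩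
  · have h1 := hg.abs_fwdDiff_iter_samples_le hB hT hs N k
    have h2 := ModuloADC.abs_fwdDiff_iter_le hη N k
    -- The noise uses up the part λ2^{N−b} of the threshold; `hsmall` keeps the signal below the
    -- rest.
    have e : (2 : ℝ) ^ N * (lam * 2 ^ (-(b : ℤ))) = lam * 2 ^ ((N : ℤ) - (b : ℤ)) := by
      rw [sub_eq_add_neg, zpow_add₀ (by norm_num), zpow_natCast]
      ring
    rw [show (fun k => ModuloADC.samples g (1 / fs) k + ModuloADC.quantError lam b g (1 / fs) k) =
      ModuloADC.samples g (1 / fs) + ModuloADC.quantError lam b g (1 / fs) from rfl,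
      fwdDiff_iter_add, Pi.add_apply]
    refine (abs_add_le _ _).trans_lt ?_
    rw [e] at h2
    linarith
  · nlinarith
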